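/- Let $H$ be a complex Hilbert space, let $\mathcal B$ be a $C^*$-algebra of operators on $H$ (a norm-closed $*$-subalgebra of $\mathcal B(H)$, not assumed unital), and let $K$ be its state space, i.e. the set of positive linear functionals of norm one on $\mathcal B$ with the weak* topology. Let $x\in H$ be a unit vector, and let $\mu$ be a positive regular Borel measure on $K$ with $0<\mu(K)\le 1$ (for example a probability measure) whose barycenter $\mu(K)^{-1}\int_K\omega\,d\mu(\omega)$, the integral being taken pointwise on $\mathcal B$, is the restriction to $\mathcal B$ of $\omega_x(A)=\langle x,Ax\rangle$. Suppose that the commutant $\mathcal B'$ is hyperfinite, i.e. $\mathcal B'$ is the weak-operator closure of the union of an upward directed family of finite-dimensional $C^*$-algebras of operators on $H$. Then there is a completely positive instrument $\mathcal E$ on $\mathcal B(H)$, that is, a family of completely positive linear maps $\mathcal E[S]:\mathcal B(H)\to\mathcal B(H)$, indexed by the Borel sets $S\subseteq K$, such that $\mathcal E[S](I)\le I$ for every $S$ and $S\mapsto\mathcal E[S](T)$ is $\sigma$-additive in the weak-operator topology for every $T\in\mathcal B(H)$, with the following two properties. It is local to $\mathcal B'$: $\mathcal E[S](T)=\mathcal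 E[S](I)\,T$ for all Borel $S\subseteq K$ and all $T\in\mathcal B''$. And \[ \langle x,\mathcal E[S](B)x\rangle=\int_S\omega(B)\,d\mu(\omega) \] for all Borel $S\subseteq K$ and all $B\in\mathcal B$. -/

import Mathlib

open MeasureTheory
open scoped InnerProductSpace ComplexOrder CStarAlgebra

noncomputable section

namespace HJW

variable {H : Type*} [NormedAddCommGroup H] [InnerProductSpace ℂ H] [CompleteSpace H]

/-- The commutant `𝓑'` of a `*`-algebra `𝓑` of bounded operators on `H`, as a von Neumann algebra:
the operators that commute with every element of `𝓑`. -/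
def commutant (𝓑 : NonUnitalStarSubalgebra ℂ (H →L[ℂ] H)) : VonNeumannAlgebra H where
  toStarSubalgebra := StarSubalgebra.centralizer ℂ (𝓑 : Set (H →L[ℂ] H))
  centralizer_centralizer' := by simp

theorem mem_commutant_iff {𝓑 : NonUnitalStarSubalgebra ℂ (H →L[ℂ] H)} {T : H →L[ℂ] H} :
    T ∈ commutant 𝓑 ↔ ∀ B ∈ 𝓑, B * T = T * B := by
  refine (StarSubalgebra.mem_centralizer_iff ℂ).trans ?_
  exact ⟨fun h B hB => (h B hB).1, fun h B hB => ⟨h B hB, h _ (star_mem hB)⟩⟩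

/-- A von Neumann algebra is hyperfinite if it is the weak-operator closure of the union of an
upward directed family of finite-dimensional `C*`-algebras. -/
def IsHyperfinite (R : VonNeumannAlgebra H) : Prop :=
  ∃ 𝓕 : Set (NonUnitalStarSubalgebra ℂ (H →L[ℂ] H)),
    𝓕.Nonempty ∧ DirectedOn (· ≤ ·) 𝓕 ∧ (∀ 𝓐 ∈ 𝓕, FiniteDimensional ℂ 𝓐) ∧
      closure (ContinuousLinearMapWOT.ofCLM '' (⋃ 𝓐 ∈ 𝓕, (𝓐 : Set (H →L[ℂ] H))) :
        Set (H →WOT[ℂ] H)) = ContinuousLinearMapWOT.ofCLM '' (R : Set (H →L[ℂ] H))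

/-- The state space of a `C*`-algebra `𝓑` of operators: the positive linear functionals of norm
one, with the weak* topology (as a subspace of the weak dual). -/
def stateSpace (𝓑 : NonUnitalStarSubalgebra ℂ (H →L[ℂ] H)) : Set (WeakDual ℂ 𝓑) :=
  {ω | (∀ b : 𝓑, 0 ≤ ω (star b * b)) ∧ ‖WeakDual.toStrongDual ω‖ = 1}

/-- The restriction to `𝓑` of the vector functional `ω_x(A) = ⟨x, A x⟩`. -/
def vectorFunctional (𝓑 : NonUnitalStarSubalgebra ℂ (H →L[ℂ] H)) (x : H) (b : 𝓑) : ℂ :=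
  ⟪x, (b : H →L[ℂ] H) x⟫_ℂ

/-- The functional `ρ` is the barycenter `μ(K)⁻¹ ∫ ω dμ(ω)` of the nonzero measure `μ` on the state
space `K` (the integral is taken in the weak sense). -/
def IsBarycenter {𝓑 : NonUnitalStarSubalgebra ℂ (H →L[ℂ] H)} [MeasurableSpace (stateSpace 𝓑)]
    (μ : Measure (stateSpace 𝓑)) (ρ : 𝓑 → ℂ) : Prop :=
  μ ≠ 0 ∧ ∀ b : 𝓑, ρ b = ((μ.real Set.univ : ℝ) : ℂ)⁻¹ * ∫ ω, (ω : WeakDual ℂ 𝓑) b ∂μ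

variable (H) in
/-- A completely positive instrument on `B(H)` with value space `X`. Only its values on measurable
sets are meaningful. -/
structure CPInstrument (X : Type*) [MeasurableSpace X] where
  /-- The operation `𝓔[S]`, a completely positive linear map. -/
  op : Set X → ((H →L[ℂ] H) →CP (H →L[ℂ] H))
  /-- For fixed `T`, the map `S ↦ 𝓔[S](T)` is `σ`-additive in the weak-operator topology. -/
  hasSum_iUnion : ∀ (T : H →L[ℂ] H) (S : ℕ → Set X), (∀ i, MeasurableSet (S i)) →
    Pairwise (Function.onFun Disjoint S) →
      ∀ y z : H, HasSum (fun i => ⟪y, op (S i) T z⟫_ℂ) ⟪y, op (⋃ i, S i) T z⟫_ℂ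
  /-- `𝓔[S](I) ≤ I`. -/
  op_one_le : ∀ S, MeasurableSet S → op S 1 ≤ 1

/-- The instrument `𝓔` is local to the algebra `𝓐` if `𝓔[S](T) = 𝓔[S](I) T` for all `T ∈ 𝓐'` and
all measurable `S`. -/
def CPInstrument.IsLocalTo {X : Type*} [MeasurableSpace X] (𝓔 : CPInstrument H X)
    (𝓐 : VonNeumannAlgebra H) : Prop :=
  ∀ T ∈ 𝓐.commutant, ∀ S, MeasurableSet S → 𝓔.op S T = 𝓔.op S 1 * T

end HJW

end

/-
For each Borel set `S`, the positive functional `b ↦ ∫_S ω(b) dμ(ω)` is dominated by the vector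
functional of `x`, so it has a Radon-Nikodym derivative `F(S)` in `𝓑'` with `0 ≤ F(S) ≤ 1`. These
operators form a positive operator valued measure. Averaging over the unitary groups of
finite-dimensional algebras whose union generates `𝓑'`, and passing to a weak limit along an
ultrafilter, gives a completely positive expectation `P` of `B(H)` onto `𝓑''`. The instrument is
`𝓔[S](T) = F(S) P(T)`: as `F(S)` commutes with `P(T)`, this equals `√F(S) P(T) √F(S)`, which is
completely positive in `T`.
-/

noncomputable section

namespace HJW

variable {H : Type*} [NormedAddCommGroup H] [InnerProductSpace ℂ H]

section Positivity

theorem nonneg_iff_forall_inner_nonneg {V : Type*} [NormedAddCommGroup V] [InnerProductSpace ℂ V]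
    {A : V →L[ℂ] V} : 0 ≤ A ↔ ∀ v, 0 ≤ ⟪v, A v⟫_ℂ := by
  rw [ContinuousLinearMap.nonneg_iff_isPositive]
  refine ⟨fun hA => hA.inner_nonneg_right, fun hA => ?_⟩
  rw [ContinuousLinearMap.isPositive_iff_complex]
  intro v
  have h : 0 ≤ ⟪A v, v⟫_ℂ := by
    rw [← inner_conj_symm]
    exact star_nonneg_iff.2 (hA v)
  obtain ⟨hre, him⟩ := Complex.nonneg_iff.1 h
  exact ⟨Complex.ext rfl (by simpa using him), hre⟩

variable {n : Type*} [Fintype n]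

/-- The operator on the `ℓ²` direct sum `Hⁿ` given by a matrix of operators on `H`. -/
def blockOperator (M : CStarMatrix n n (H →L[ℂ] H)) :
    PiLp 2 (fun _ : n => H) →L[ℂ] PiLp 2 (fun _ : n => H) :=
  (PiLp.continuousLinearEquiv 2 ℂ fun _ : n => H).symm ∘L
    ContinuousLinearMap.pi fun i => ∑ j, M i j ∘L PiLp.proj 2 (fun _ : n => H) j

theorem blockOperator_apply (M : CStarMatrix n n (H →L[ℂ] H)) (v : PiLp 2 fun _ : n => H) (i : n) :
    blockOperator M v i = ∑ j, M i j (v j) := by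
  simp [blockOperator]

theorem inner_blockOperator_apply (M : CStarMatrix n n (H →L[ℂ] H))
    (v w : PiLp 2 fun _ : n => H) :
    ⟪v, blockOperator M w⟫_ℂ = ∑ i, ∑ j, ⟪v i, M i j (w j)⟫_ℂ := by
  simp [PiLp.inner_apply, blockOperator_apply, inner_sum]

theorem blockOperator_mul (M N : CStarMatrix n n (H →L[ℂ] H)) :
    blockOperator (M * N) = blockOperator M * blockOperator N := by
  ext v i
  simp only [blockOperator_apply, CStarMatrix.mul_apply, mul_apply_eq_comp, sum_apply, map_sum]
  exact Finset.sum_comm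

variable [CompleteSpace H]

theorem blockOperator_star (M : CStarMatrix n n (H →L[ℂ] H)) :
    blockOperator (star M) = star (blockOperator M) := by
  rw [ContinuousLinearMap.star_eq_adjoint, ContinuousLinearMap.eq_adjoint_iff]
  intro v w
  rw [inner_blockOperator_apply, Finset.sum_comm]
  simp [PiLp.inner_apply, blockOperator_apply, sum_inner, CStarMatrix.star_apply,
    ContinuousLinearMap.star_eq_adjoint, ContinuousLinearMap.adjoint_inner_left]

variable (H n) in
/-- Matrices of operators on `H` are the operators on `Hⁿ`; being an isomorphism of star algebras,
this identification preserves the order in both directions. -/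
def blockOperatorEquiv [DecidableEq n] : CStarMatrix n n (H →L[ℂ] H) ≃⋆ₐ[ℂ]
    (PiLp 2 (fun _ : n => H) →L[ℂ] PiLp 2 (fun _ : n => H)) where
  toFun := blockOperator
  invFun A := CStarMatrix.ofMatrix <| Matrix.of fun i j => PiLp.proj 2 (fun _ : n => H) i ∘L A ∘L
    (PiLp.continuousLinearEquiv 2 ℂ fun _ : n => H).symm.toContinuousLinearMap ∘L
      ContinuousLinearMap.single ℂ (fun _ : n => H) j
  left_inv M := by
    ext i j y
    simp [blockOperator_apply, apply_ite]
  right_inv A := by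
    ext v i
    have hv : v = ∑ j, PiLp.single 2 j (v j) := by
      ext k; simp [Pi.single_apply]
    conv_rhs => rw [hv]
    simp [blockOperator_apply]
  map_mul' := blockOperator_mul
  map_add' M N := by
    ext v i
    simp [blockOperator_apply, Finset.sum_add_distrib]
  map_star' := blockOperator_star
  map_smul' r M := by
    ext v i
    simp [blockOperator_apply, Finset.smul_sum]

theorem cstarMatrix_nonneg_iff {M : CStarMatrix n n (H →L[ℂ] H)} :
    0 ≤ M ↔ ∀ v : n → H, 0 ≤ ∑ i, ∑ j, ⟪v i, M i j (v j)⟫_ℂ := by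
  classical
  have hM : 0 ≤ M ↔ 0 ≤ blockOperator M := by
    rw [← map_le_map_iff (blockOperatorEquiv H n), map_zero]
    rfl
  simp_rw [hM, nonneg_iff_forall_inner_nonneg, inner_blockOperator_apply]
  exact ⟨fun h v => h (WithLp.toLp 2 v), fun h v => h v⟩

end Positivity

variable [CompleteSpace H]

section CompletelyPositiveMaps

variable {A : Type*} [NonUnitalCStarAlgebra A] [PartialOrder A] [StarOrderedRing A]

theorem sum_inner_map_nonneg (Φ : A →CP (H →L[ℂ] H)) {n : Type*} [Fintype n]
    {M : CStarMatrix n n A} (hM : 0 ≤ M) (v : n → H) :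
    0 ≤ ∑ i, ∑ j, ⟪v i, Φ (M i j) (v j)⟫_ℂ :=
  cstarMatrix_nonneg_iff.1 (Φ.map_cstarMatrix_nonneg M hM) v

/-- The completely positive map given by a linear map into `B(H)` that sends positive matrices to
matrices with positive quadratic form. -/
def completelyPositiveOfInner (Φ : A →ₗ[ℂ] (H →L[ℂ] H))
    (hΦ : ∀ (k : ℕ) (M : CStarMatrix (Fin k) (Fin k) A), 0 ≤ M →
      ∀ v : Fin k → H, 0 ≤ ∑ i, ∑ j, ⟪v i, Φ (M i j) (v j)⟫_ℂ) : A →CP (H →L[ℂ] H) where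
  toLinearMap := Φ
  map_cstarMatrix_nonneg' k M hM := cstarMatrix_nonneg_iff.2 (hΦ k M hM)

variable {K : Type*} [NormedAddCommGroup K] [InnerProductSpace ℂ K] [CompleteSpace K]

/-- The completely positive map `a ↦ V* Φ(a) V`. -/
def compress (Φ : A →CP (H →L[ℂ] H)) (V : K →L[ℂ] H) : A →CP (K →L[ℂ] K) :=
  completelyPositiveOfInner
    { toFun := fun a => V.adjoint ∘L Φ a ∘L V
      map_add' := fun a b => by ext; simp
      map_smul' := fun r a => by ext; simp }
    fun k M hM v => by
      simpa [ContinuousLinearMap.adjoint_inner_right] using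
        sum_inner_map_nonneg Φ hM fun i => V (v i)

theorem compress_apply (Φ : A →CP (H →L[ℂ] H)) (V : K →L[ℂ] H) (a : A) :
    compress Φ V a = V.adjoint ∘L Φ a ∘L V := rfl

end CompletelyPositiveMaps

section UnitaryAverage

variable {G : Type*} [Group G] [TopologicalSpace G] [CompactSpace G] [MeasurableSpace G]
  [BorelSpace G] (ν : Measure G) (π : G →ₜ* unitary (H →L[ℂ] H))

theorem inner_integral_apply {X : Type*} [MeasurableSpace X] {ν : Measure X}
    {F : X → (H →L[ℂ] H)} (hF : Integrable F ν) (v w : H) :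
    ⟪v, (∫ u, F u ∂ν) w⟫_ℂ = ∫ u, ⟪v, F u w⟫_ℂ ∂ν :=
  (ContinuousLinearMap.integral_comp_comm
    ((innerSL ℂ v).comp (ContinuousLinearMap.apply ℂ H w)) hF).symm

theorem integrable_inner_apply {X : Type*} [MeasurableSpace X] {ν : Measure X}
    {F : X → (H →L[ℂ] H)} (hF : Integrable F ν) (v w : H) :
    Integrable (fun u => ⟪v, F u w⟫_ℂ) ν :=
  ((innerSL ℂ v).comp (ContinuousLinearMap.apply ℂ H w)).integrable_comp hF

theorem integrable_unitary_conj [IsFiniteMeasure ν] (T : H →L[ℂ] H) :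
    Integrable (fun g => (π g : H →L[ℂ] H) * T * star (π g : H →L[ℂ] H)) ν :=
  have hπ : Continuous fun g => (π g : H →L[ℂ] H) :=
    continuous_subtype_val.comp π.continuous_toFun
  ((hπ.mul continuous_const).mul hπ.star).integrable_of_hasCompactSupport
    (HasCompactSupport.of_compactSpace _)

/-- The average `∫ π(g) T π(g)* dν(g)` over a compact group, for a norm-continuous unitary
representation `π`, as a completely positive map. -/
def unitaryAverage [IsFiniteMeasure ν] : (H →L[ℂ] H) →CP (H →L[ℂ] H) :=
  completelyPositiveOfInner
    { toFun := fun T => ∫ g, (π g : H →L[ℂ] H) * T * star (π g : H →L[ℂ] H) ∂ν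
      map_add' := fun S T => by
        rw [← integral_add (integrable_unitary_conj ν π S) (integrable_unitary_conj ν π T)]
        simp only [mul_add, add_mul]
      map_smul' := fun r T => by
        rw [← integral_smul]
        simp only [mul_smul_comm, smul_mul_assoc, RingHom.id_apply] }
    fun k M hM v => by
      have hint := fun i j =>
        integrable_inner_apply (integrable_unitary_conj ν π (M i j)) (v i) (v j)
      simp only [LinearMap.coe_mk, AddHom.coe_mk,
        inner_integral_apply (integrable_unitary_conj ν π _)]
      simp_rw [← integral_finsetSum Finset.univ fun j _ => hint _ j]
      rw [← integral_finsetSum _ fun i _ => integrable_finsetSum _ fun j _ => hint i j]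
      refine integral_nonneg fun g => ?_
      simpa [ContinuousLinearMap.star_eq_adjoint, ContinuousLinearMap.adjoint_inner_left] using
        cstarMatrix_nonneg_iff.1 hM fun i => star (π g : H →L[ℂ] H) (v i)

theorem unitaryAverage_apply [IsFiniteMeasure ν] (T : H →L[ℂ] H) :
    unitaryAverage ν π T = ∫ g, (π g : H →L[ℂ] H) * T * star (π g : H →L[ℂ] H) ∂ν := rfl

theorem norm_unitaryAverage_le [IsProbabilityMeasure ν] (T : H →L[ℂ] H) :
    ‖unitaryAverage ν π T‖ ≤ ‖T‖ := by
  rw [unitaryAverage_apply]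
  refine (norm_integral_le_of_norm_le_const (C := ‖T‖) (.of_forall fun g => ?_)).trans (by simp)
  rw [CStarRing.norm_mul_mem_unitary _ (Unitary.star_mem (π g).2),
    CStarRing.norm_mem_unitary_mul _ (π g).2]

theorem unitaryAverage_of_commute [IsProbabilityMeasure ν] {T : H →L[ℂ] H}
    (hT : ∀ g, Commute (π g : H →L[ℂ] H) T) : unitaryAverage ν π T = T := by
  have h : ∀ g, (π g : H →L[ℂ] H) * T * star (π g : H →L[ℂ] H) = T := fun g => by
    rw [(hT g).eq, mul_assoc, Unitary.mul_star_self_of_mem (π g).2, mul_one]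
  simp [unitaryAverage_apply, h]

theorem commute_unitaryAverage [IsTopologicalGroup G] [IsFiniteMeasure ν] [ν.IsMulLeftInvariant]
    (g : G) (T : H →L[ℂ] H) : Commute (π g : H →L[ℂ] H) (unitaryAverage ν π T) := by
  have hconj : (π g : H →L[ℂ] H) * unitaryAverage ν π T * star (π g : H →L[ℂ] H) =
      unitaryAverage ν π T := by
    have hint := integrable_unitary_conj ν π T
    calc (π g : H →L[ℂ] H) * unitaryAverage ν π T * star (π g : H →L[ℂ] H)
        = ∫ h, (π (g * h) : H →L[ℂ] H) * T * star (π (g * h) : H →L[ℂ] H) ∂ν := by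
          rw [unitaryAverage_apply, ← integral_const_mul_of_integrable hint,
            ← integral_mul_const_of_integrable (hint.const_mul _)]
          simp only [map_mul, Submonoid.coe_mul, star_mul, mul_assoc]
      _ = unitaryAverage ν π T :=
          integral_mul_left_eq_self (fun h => (π h : H →L[ℂ] H) * T * star (π h : H →L[ℂ] H)) g
  calc (π g : H →L[ℂ] H) * unitaryAverage ν π T
      = (π g : H →L[ℂ] H) * unitaryAverage ν π T * (star (π g : H →L[ℂ] H) * π g) := by
        rw [Unitary.star_mul_self_of_mem (π g).2, mul_one]
    _ = unitaryAverage ν π T * π g := by rw [← mul_assoc, hconj]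

end UnitaryAverage

section Expectation

open Filter Topology

/-- The completely positive map `P` is an expectation (a projection of norm one) of `B(H)` onto the
von Neumann algebra `R`. -/
structure IsExpectationOnto (P : (H →L[ℂ] H) →CP (H →L[ℂ] H)) (R : VonNeumannAlgebra H) :
    Prop where
  apply_mem : ∀ T, P T ∈ R
  apply_of_mem : ∀ T ∈ R, P T = T

/-- A von Neumann algebra on `H` is injective if it is the range of an expectation of `B(H)`. -/
def IsInjective (R : VonNeumannAlgebra H) : Prop :=
  ∃ P : (H →L[ℂ] H) →CP (H →L[ℂ] H), IsExpectationOnto P R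

theorem isCompact_unitary {A : Type*} [CStarAlgebra A] [FiniteDimensional ℂ A] :
    IsCompact (unitary A : Set A) := by
  have : ProperSpace A := FiniteDimensional.proper ℂ A
  refine Metric.isCompact_of_isClosed_isBounded isClosed_unitary ?_
  refine (Metric.isBounded_closedBall (x := (0 : A)) (r := 1)).subset fun u hu => ?_
  nontriviality A
  simpa using (CStarRing.norm_of_mem_unitary hu).le

/-- The unitary group of a `*`-algebra of operators, acting on `H`. -/
def unitaryInclusion (V : StarSubalgebra ℂ (H →L[ℂ] H)) : unitary V →ₜ* unitary (H →L[ℂ] H) where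
  toFun := Subtype.map V.subtype fun _ => Unitary.map_mem V.subtype
  map_one' := rfl
  map_mul' _ _ := rfl
  continuous_toFun := (continuous_subtype_val.comp continuous_subtype_val).subtype_mk _

theorem commute_of_forall_unitary {V : StarSubalgebra ℂ (H →L[ℂ] H)}
    (hV : IsClosed (V : Set (H →L[ℂ] H))) {T : H →L[ℂ] H}
    (hT : ∀ u : unitary V, Commute ((u : V) : H →L[ℂ] H) T) (a : V) :
    Commute (a : H →L[ℂ] H) T := by
  let _ : CStarAlgebra V := StarSubalgebra.cstarAlgebra V (h_closed := hV)
  have ha : a ∈ Submodule.span ℂ (unitary V : Set V) := by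
    rw [CStarAlgebra.span_unitary]
    trivial
  induction ha using Submodule.span_induction with
  | mem u hu => exact hT ⟨u, hu⟩
  | zero => exact Commute.zero_left T
  | add a b _ _ ha hb => exact ha.add_left hb
  | smul r a _ ha => exact ha.smul_left r

theorem exists_expectation_commutant_starSubalgebra (V : StarSubalgebra ℂ (H →L[ℂ] H))
    [FiniteDimensional ℂ V] :
    ∃ P, IsExpectationOnto P (commutant V.toNonUnitalStarSubalgebra) ∧ ∀ T, ‖P T‖ ≤ ‖T‖ := by
  have hV : IsClosed (V : Set (H →L[ℂ] H)) :=
    Submodule.closed_of_finiteDimensional (Subalgebra.toSubmodule V.toSubalgebra)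
  let _ : CStarAlgebra V := StarSubalgebra.cstarAlgebra V (h_closed := hV)
  have : CompactSpace (unitary V) := isCompact_iff_compactSpace.1 isCompact_unitary
  let _ : MeasurableSpace (unitary V) := borel _
  have : BorelSpace (unitary V) := ⟨rfl⟩
  let ν : Measure (unitary V) := Measure.haarMeasure ⊤
  have : IsProbabilityMeasure ν := ⟨Measure.haarMeasure_self⟩
  refine ⟨unitaryAverage ν (unitaryInclusion V), ⟨fun T => mem_commutant_iff.2 fun a ha => ?_,
    fun T hT => ?_⟩, norm_unitaryAverage_le ν _⟩
  · exact commute_of_forall_unitary hV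
      (fun u => commute_unitaryAverage ν (unitaryInclusion V) u T) ⟨a, ha⟩
  · exact unitaryAverage_of_commute ν _ fun u => mem_commutant_iff.1 hT _ (u : V).2

theorem commutant_adjoin (𝓐 : NonUnitalStarSubalgebra ℂ (H →L[ℂ] H)) :
    commutant (StarAlgebra.adjoin ℂ (𝓐 : Set (H →L[ℂ] H))).toNonUnitalStarSubalgebra =
      commutant 𝓐 := by
  have hle : StarAlgebra.adjoin ℂ (𝓐 : Set (H →L[ℂ] H)) ≤
      (commutant 𝓐).commutant.toStarSubalgebra :=
    StarAlgebra.adjoin_le fun a ha =>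
      VonNeumannAlgebra.mem_commutant_iff.2 fun T hT => (mem_commutant_iff.1 hT a ha).symm
  ext T
  refine ⟨fun hT => mem_commutant_iff.2 fun a ha => mem_commutant_iff.1 hT a
    (StarAlgebra.subset_adjoin ℂ _ ha), fun hT => mem_commutant_iff.2 fun a ha => ?_⟩
  exact (VonNeumannAlgebra.mem_commutant_iff.1 (hle ha) T hT).symm

theorem finiteDimensional_adjoin (𝓐 : NonUnitalStarSubalgebra ℂ (H →L[ℂ] H))
    [FiniteDimensional ℂ 𝓐] :
    FiniteDimensional ℂ (StarAlgebra.adjoin ℂ (𝓐 : Set (H →L[ℂ] H))) := by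
  rw [← NonUnitalStarSubalgebra.unitization_range]
  have : FiniteDimensional ℂ (Unitization ℂ 𝓐) :=
    Module.Finite.equiv (Unitization.linearEquiv ℂ ℂ 𝓐).symm
  exact Module.Finite.range (NonUnitalStarSubalgebra.unitization 𝓐).toAlgHom.toLinearMap

theorem exists_expectation_commutant (𝓐 : NonUnitalStarSubalgebra ℂ (H →L[ℂ] H))
    [FiniteDimensional ℂ 𝓐] :
    ∃ P, IsExpectationOnto P (commutant 𝓐) ∧ ∀ T, ‖P T‖ ≤ ‖T‖ := by
  have := finiteDimensional_adjoin 𝓐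
  rw [← commutant_adjoin 𝓐]
  exact exists_expectation_commutant_starSubalgebra _

theorem exists_tendsto_ofCLM_of_norm_le {ι : Type*} (U : Ultrafilter ι) {A : ι → H →L[ℂ] H} {C : ℝ}
    (hA : ∀ i, ‖A i‖ ≤ C) : ∃ L : H →L[ℂ] H,
      Tendsto (fun i => ContinuousLinearMapWOT.ofCLM (A i)) U
        (𝓝 (ContinuousLinearMapWOT.ofCLM L)) := by
  have hbound : ∀ i v w, ‖⟪A i v, w⟫_ℂ‖ ≤ C * ‖v‖ * ‖w‖ := fun i v w =>
    (norm_inner_le_norm _ _).trans (by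
      gcongr
      exact (A i).le_of_opNorm_le (hA i) v)
  have hex : ∀ v w, ∃ z, Tendsto (fun i => ⟪A i v, w⟫_ℂ) U (𝓝 z) := by
    intro v w
    obtain ⟨z, -, hz⟩ := (isCompact_closedBall (0 : ℂ) (C * ‖v‖ * ‖w‖)).ultrafilter_le_nhds
      (U.map fun i => ⟪A i v, w⟫_ℂ)
      (le_principal_iff.2 <| mem_map.2 <| Eventually.of_forall fun i => by simpa using hbound i v w)
    exact ⟨z, hz⟩
  choose g hg using hex
  let B₀ : H →ₗ⋆[ℂ] H →ₗ[ℂ] ℂ := LinearMap.mk₂'ₛₗ (starRingEnd ℂ) (RingHom.id ℂ) g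
    (fun v v' w => tendsto_nhds_unique (hg _ _) (by
      simpa [inner_add_left] using (hg v w).add (hg v' w)))
    (fun r v w => tendsto_nhds_unique (hg _ _) (by
      simpa [inner_smul_left, mul_comm] using (hg v w).const_mul ((starRingEnd ℂ) r)))
    (fun v w w' => tendsto_nhds_unique (hg _ _) (by
      simpa [inner_add_right] using (hg v w).add (hg v w')))
    (fun r v w => tendsto_nhds_unique (hg _ _) (by
      simpa [inner_smul_right] using (hg v w).const_mul r))
  let B : H →L⋆[ℂ] H →L[ℂ] ℂ := B₀.mkContinuous₂ C fun v w =>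
    le_of_tendsto (hg v w).norm (.of_forall fun i => hbound i v w)
  refine ⟨InnerProductSpace.continuousLinearMapOfBilin B,
    ContinuousLinearMapWOT.tendsto_iff_forall_inner_apply_tendsto.2 fun w v => ?_⟩
  have hB : Tendsto (fun i => ⟪A i w, v⟫_ℂ) U
      (𝓝 ⟪InnerProductSpace.continuousLinearMapOfBilin B w, v⟫_ℂ) := by
    rw [InnerProductSpace.continuousLinearMapOfBilin_apply]
    exact hg w v
  simpa only [Function.comp_def, inner_conj_symm] using!
    (Complex.continuous_conj.tendsto _).comp hB

theorem exists_completelyPositive_tendsto {A : Type*} [NonUnitalCStarAlgebra A] [PartialOrder A]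
    [StarOrderedRing A] {ι : Type*} (U : Ultrafilter ι) {Q : ι → (A →CP (H →L[ℂ] H))}
    (hQ : ∀ a, ∃ C, ∀ i, ‖Q i a‖ ≤ C) : ∃ P : A →CP (H →L[ℂ] H), ∀ a,
      Tendsto (fun i => ContinuousLinearMapWOT.ofCLM (Q i a)) U
        (𝓝 (ContinuousLinearMapWOT.ofCLM (P a))) := by
  choose L hL using fun a => (hQ a).elim fun _ => exists_tendsto_ofCLM_of_norm_le U
  refine ⟨completelyPositiveOfInner
    { toFun := L
      map_add' := fun a b => ContinuousLinearMapWOT.ofCLM_injective <|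
        tendsto_nhds_unique (hL _) (by simpa using (hL a).add (hL b))
      map_smul' := fun r a => ContinuousLinearMapWOT.ofCLM_injective <|
        tendsto_nhds_unique (hL _) (by simpa using (hL a).const_smul r) }
    fun k M hM v => ?_, hL⟩
  exact ge_of_tendsto (tendsto_finsetSum _ fun i _ => tendsto_finsetSum _ fun j _ =>
    ContinuousLinearMapWOT.tendsto_iff_forall_inner_apply_tendsto.1 (hL (M i j)) (v j) (v i))
    (.of_forall fun i => sum_inner_map_nonneg (Q i) hM v)

theorem mem_commutant_iff_of_closure_eq {R : VonNeumannAlgebra H} {s : Set (H →L[ℂ] H)}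
    (hs : closure (ContinuousLinearMapWOT.ofCLM '' s : Set (H →WOT[ℂ] H)) =
      ContinuousLinearMapWOT.ofCLM '' (R : Set (H →L[ℂ] H))) {T : H →L[ℂ] H} :
    T ∈ R.commutant ↔ ∀ a ∈ s, a * T = T * a := by
  rw [VonNeumannAlgebra.mem_commutant_iff]
  refine ⟨fun hT a ha => ?_, fun hT a ha => ?_⟩
  · obtain ⟨b, hb, hba⟩ := hs ▸ subset_closure (Set.mem_image_of_mem _ ha)
    exact ContinuousLinearMapWOT.ofCLM_injective hba ▸ hT b hb
  · have hclosed : IsClosed {b : H →WOT[ℂ] H | b * ContinuousLinearMapWOT.ofCLM T =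
        ContinuousLinearMapWOT.ofCLM T * b} :=
      isClosed_eq (continuous_mul_const _) (continuous_const_mul _)
    have hmem : ContinuousLinearMapWOT.ofCLM a ∈ closure (ContinuousLinearMapWOT.ofCLM '' s) :=
      hs ▸ Set.mem_image_of_mem _ ha
    refine ContinuousLinearMapWOT.ofCLM_injective (closure_minimal ?_ hclosed hmem)
    rintro _ ⟨b, hb, rfl⟩
    exact congrArg ContinuousLinearMapWOT.ofCLM (hT b hb)

theorem IsHyperfinite.isInjective_commutant {R : VonNeumannAlgebra H} (hR : IsHyperfinite R) :
    IsInjective R.commutant := by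
  obtain ⟨𝓕, hne, hdir, hfin, hcl⟩ := hR
  have hmem {T : H →L[ℂ] H} : T ∈ R.commutant ↔ ∀ 𝓐 : 𝓕, T ∈ commutant 𝓐.1 := by
    simp only [mem_commutant_iff_of_closure_eq hcl, Set.mem_iUnion₂, mem_commutant_iff,
      SetLike.mem_coe, Subtype.forall]
    grind
  have : Nonempty 𝓕 := hne.to_subtype
  have : IsDirectedOrder 𝓕 := ⟨hdir.directed_val⟩
  choose Q hQ hnorm using fun 𝓐 : 𝓕 =>
    have := hfin 𝓐 𝓐.2
    exists_expectation_commutant 𝓐.1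
  let U : Ultrafilter 𝓕 := Ultrafilter.of atTop
  obtain ⟨P, hP⟩ := exists_completelyPositive_tendsto U fun T => ⟨‖T‖, fun 𝓐 => hnorm 𝓐 T⟩
  refine ⟨P, fun T => hmem.2 fun 𝓐 => mem_commutant_iff.2 fun a ha => ?_, fun T hT => ?_⟩
  · have heventually : ∀ᶠ 𝓒 in U, a * Q 𝓒 T = Q 𝓒 T * a := by
      filter_upwards [Ultrafilter.of_le _ (eventually_ge_atTop 𝓐)] with 𝓒 h𝓒
      exact mem_commutant_iff.1 ((hQ 𝓒).apply_mem T) a (h𝓒 ha)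
    refine ContinuousLinearMapWOT.ofCLM_injective <| tendsto_nhds_unique
      ((hP T).const_mul (ContinuousLinearMapWOT.ofCLM a))
      (((hP T).mul_const (ContinuousLinearMapWOT.ofCLM a)).congr' ?_)
    filter_upwards [heventually] with 𝓒 h𝓒
    exact congrArg ContinuousLinearMapWOT.ofCLM h𝓒.symm
  · refine ContinuousLinearMapWOT.ofCLM_injective (tendsto_nhds_unique (hP T) ?_)
    simp only [fun 𝓐 => (hQ 𝓐).apply_of_mem T (hmem.1 hT 𝓐), tendsto_const_nhds]

end Expectation

section DominatedForm

open Filter Topology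

section PositiveForm

universe u

variable {E : Type u} [AddCommGroup E] [Module ℂ E] {q : E →ₗ⋆[ℂ] E →ₗ[ℂ] ℂ}

theorem sesquilinear_conj_symm_of_nonneg (hq : ∀ b, 0 ≤ q b b) (b c : E) :
    (starRingEnd ℂ) (q c b) = q b c := by
  have him : ∀ b, (q b b).im = 0 := fun b => (Complex.nonneg_iff.1 (hq b)).2.symm
  have hadd := him (b + c)
  have haddI := him (b + Complex.I • c)
  simp [him] at hadd haddI
  refine Complex.ext ?_ ?_ <;> simp <;> linarith

theorem exists_inner_eq_of_nonneg (hq : ∀ b, 0 ≤ q b b) :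
    ∃ (L : Type u) (_ : NormedAddCommGroup L) (_ : InnerProductSpace ℂ L) (_ : CompleteSpace L)
      (ι : E →ₗ[ℂ] L), ∀ c b, ⟪ι c, ι b⟫_ℂ = q c b := by
  let core : PreInnerProductSpace.Core ℂ E :=
    { inner := fun c b => q c b
      conj_inner_symm := sesquilinear_conj_symm_of_nonneg hq
      re_inner_nonneg := fun b => (Complex.nonneg_iff.1 (hq b)).1
      add_left := fun a b c => by simp
      smul_left := fun a b r => by simp }
  let _ : SeminormedAddCommGroup E := InnerProductSpace.Core.toSeminormedAddCommGroup (c := core)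
  let _ : InnerProductSpace ℂ E := InnerProductSpace.ofCore core
  exact ⟨UniformSpace.Completion E, inferInstance, inferInstance, inferInstance,
    (UniformSpace.Completion.toComplₗᵢ (𝕜 := ℂ) (E := E)).toLinearMap,
    UniformSpace.Completion.inner_coe⟩

end PositiveForm

variable {E : Type*} [AddCommGroup E] [Module ℂ E]

/-- The closure of the range of a linear map into `H`. -/
abbrev closedRange (j : E →ₗ[ℂ] H) : Submodule ℂ H := (LinearMap.range j).topologicalClosure

/-- The operator `T` represents the sesquilinear form `q` through `j`: it lives on the closure of
the range of `j`, and the pull-back of its quadratic form along `j` is `q`. -/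
structure Represents (j : E →ₗ[ℂ] H) (q : E →ₗ⋆[ℂ] E →ₗ[ℂ] ℂ) (T : H →L[ℂ] H) : Prop where
  compress : (closedRange j).starProjection * T * (closedRange j).starProjection = T
  inner_eq : ∀ c b, ⟪j c, T (j b)⟫_ℂ = q c b

theorem exists_extend_closedRange {L : Type*} [NormedAddCommGroup L] [InnerProductSpace ℂ L]
    [CompleteSpace L] (j : E →ₗ[ℂ] H) (ι : E →ₗ[ℂ] L) (hι : ∀ b, ‖ι b‖ ≤ ‖j b‖) :
    ∃ V : H →L[ℂ] L, (∀ b, V (j b) = ι b) ∧ V ∘L (closedRange j).starProjection = V := by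
  let K := closedRange j
  let e : E →ₗ[ℂ] K := j.codRestrict K fun b =>
    (LinearMap.range j).le_topologicalClosure (LinearMap.mem_range_self j b)
  have he : DenseRange e := fun y => by
    have hrange : ((↑) '' Set.range e : Set H) = LinearMap.range j := (Set.range_comp _ _).symm
    rw [closure_subtype, hrange]
    exact y.2
  have hproj (y : K) : K.orthogonalProjectionOnto y = y :=
    Submodule.orthogonalProjectionOnto_mem_subspace_eq_self y
  refine ⟨ι.extendOfNorm e ∘L K.orthogonalProjectionOnto, fun b => ?_, ?_⟩
  · rw [ContinuousLinearMap.comp_apply, show j b = e b from rfl, hproj]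
    exact LinearMap.extendOfNorm_eq he ⟨1, fun b => (hι b).trans_eq (one_mul _).symm⟩ b
  · ext y
    exact congrArg (ι.extendOfNorm e) (hproj _)

theorem exists_represents {j : E →ₗ[ℂ] H} {q : E →ₗ⋆[ℂ] E →ₗ[ℂ] ℂ} (hq : ∀ b, 0 ≤ q b b)
    (hj : ∀ b, q b b ≤ ⟪j b, j b⟫_ℂ) : ∃ T, Represents j q T := by
  obtain ⟨L, _, _, _, ι, hι⟩ := exists_inner_eq_of_nonneg hq
  obtain ⟨V, hVj, hVp⟩ := exists_extend_closedRange j ι fun b => by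
    have hsq := hj b
    rw [← hι, inner_self_eq_norm_sq_to_K, inner_self_eq_norm_sq_to_K] at hsq
    exact (sq_le_sq₀ (norm_nonneg _) (norm_nonneg _)).1 (by exact_mod_cast hsq)
  refine ⟨V.adjoint ∘L V, ?_, fun c b => ?_⟩
  · have hpV := congrArg ContinuousLinearMap.adjoint hVp
    rw [ContinuousLinearMap.adjoint_comp, (isSelfAdjoint_starProjection _).adjoint_eq] at hpV
    change (_ ∘L (V.adjoint ∘L V)) ∘L _ = _
    rw [← ContinuousLinearMap.comp_assoc, hpV, ContinuousLinearMap.comp_assoc, hVp]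
  · rw [ContinuousLinearMap.comp_apply, ContinuousLinearMap.adjoint_inner_right, hVj, hVj, hι]

theorem inner_eq_inner_starProjection {V : Type*} [NormedAddCommGroup V] [InnerProductSpace ℂ V]
    {K : Submodule ℂ V} [K.HasOrthogonalProjection] {T : V →L[ℂ] V}
    (hT : K.starProjection * T * K.starProjection = T) (y z : V) :
    ⟪y, T z⟫_ℂ = ⟪K.starProjection y, T (K.starProjection z)⟫_ℂ := by
  conv_lhs => rw [← hT]
  simp [Submodule.inner_starProjection_left_eq_right]

theorem nonneg_of_forall_inner_map_nonneg {j : E →ₗ[ℂ] H} {T : H →L[ℂ] H}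
    (hT : (closedRange j).starProjection * T * (closedRange j).starProjection = T)
    (h : ∀ b, 0 ≤ ⟪j b, T (j b)⟫_ℂ) : 0 ≤ T := by
  have hrange : (LinearMap.range j : Set H) ⊆ {y | 0 ≤ ⟪y, T y⟫_ℂ} := by
    rintro _ ⟨b, rfl⟩
    exact h b
  refine nonneg_iff_forall_inner_nonneg.2 fun v => ?_
  rw [inner_eq_inner_starProjection hT]
  exact closure_minimal hrange (isClosed_le (by fun_prop) (by fun_prop))
    (Submodule.starProjection_apply_mem (closedRange j) v)

theorem commute_starProjection_closedRange {j : E →ₗ[ℂ] H} {d : H →L[ℂ] H}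
    (hd : ∀ b, d (j b) ∈ LinearMap.range j) (hd' : ∀ b, star d (j b) ∈ LinearMap.range j) :
    Commute d (closedRange j).starProjection := by
  have hmul : ∀ a : H →L[ℂ] H, (∀ b, a (j b) ∈ LinearMap.range j) →
      (closedRange j).starProjection * (a * (closedRange j).starProjection) =
        a * (closedRange j).starProjection := by
    intro a ha
    have hmaps : Set.MapsTo a (closedRange j) (closedRange j) :=
      Set.MapsTo.closure (by rintro _ ⟨b, rfl⟩; exact ha b) a.continuous
    ext y
    exact Submodule.starProjection_eq_self_iff.2
      (hmaps (Submodule.starProjection_apply_mem (closedRange j) y))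
  have hstar := congrArg star (hmul (star d) hd')
  simp only [star_mul, star_star, (isSelfAdjoint_starProjection _).star_eq] at hstar
  rw [Commute, SemiconjBy, ← hmul d hd, ← mul_assoc, hstar]

theorem isClosed_setOf_tendsto_of_norm_le {V W : Type*} [NormedAddCommGroup V] [NormedSpace ℂ V]
    [NormedAddCommGroup W] [NormedSpace ℂ W] {σ : ℂ →+* ℂ} [RingHomIsometric σ] {ι : Type*}
    {l : Filter ι} {A : ι → V →SL[σ] W} {B : V →SL[σ] W} {C : ℝ}
    (hA : ∀ i, ‖A i‖ ≤ C) :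
    IsClosed {v | Tendsto (fun i => A i v) l (𝓝 (B v))} :=
  have hlip (i : ι) : LipschitzWith C.toNNReal (A i) :=
    (A i).lipschitz.weaken (NNReal.coe_le_coe.1 ((hA i).trans (Real.le_coe_toNNReal C)))
  (LipschitzWith.uniformEquicontinuous _ _ hlip).equicontinuous.isClosed_setOfPred_tendsto
    B.continuous

theorem tendsto_inner_of_mem_closure {V : Type*} [NormedAddCommGroup V] [InnerProductSpace ℂ V]
    {ι : Type*} {l : Filter ι} {A : ι → (V →L[ℂ] V)} {B : V →L[ℂ] V} {C : ℝ}
    (hA : ∀ i, ‖A i‖ ≤ C) {D : Set V}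
    (hD : ∀ y ∈ D, ∀ z ∈ D, Tendsto (fun i => ⟪y, A i z⟫_ℂ) l (𝓝 ⟪y, B z⟫_ℂ))
    {y z : V} (hy : y ∈ closure D) (hz : z ∈ closure D) :
    Tendsto (fun i => ⟪y, A i z⟫_ℂ) l (𝓝 ⟪y, B z⟫_ℂ) := by
  have hclosed_right (y : V) : IsClosed {z | Tendsto (fun i => ⟪y, A i z⟫_ℂ) l (𝓝 ⟪y, B z⟫_ℂ)} :=
    isClosed_setOf_tendsto_of_norm_le (A := fun i => innerSL ℂ y ∘L A i) (B := innerSL ℂ y ∘L B)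
      (C := ‖y‖ * C) fun i => (ContinuousLinearMap.opNorm_comp_le _ _).trans (by
        rw [innerSL_apply_norm]
        gcongr
        exact hA i)
  have hclosed_left (z : V) : IsClosed {y | Tendsto (fun i => ⟪y, A i z⟫_ℂ) l (𝓝 ⟪y, B z⟫_ℂ)} :=
    isClosed_setOf_tendsto_of_norm_le (A := fun i => innerSLFlip ℂ (A i z))
      (B := innerSLFlip ℂ (B z)) (C := C * ‖z‖) fun i =>
        (ContinuousLinearMap.opNorm_le_bound _ (norm_nonneg (A i z)) fun y => by
          simpa [mul_comm] using norm_inner_le_norm y (A i z)).trans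
            ((A i).le_of_opNorm_le (hA i) z)
  exact closure_minimal (fun y hy => closure_minimal (hD y hy) (hclosed_right y) hz)
    (hclosed_left z) hy

namespace Represents

variable {j : E →ₗ[ℂ] H} {q : E →ₗ⋆[ℂ] E →ₗ[ℂ] ℂ} {T : H →L[ℂ] H}

theorem nonneg (hT : Represents j q T) (hq : ∀ b, 0 ≤ q b b) : 0 ≤ T :=
  nonneg_of_forall_inner_map_nonneg hT.compress fun b => (hq b).trans_eq (hT.inner_eq b b).symm

theorem le_one (hT : Represents j q T) (hj : ∀ b, q b b ≤ ⟪j b, j b⟫_ℂ) : T ≤ 1 := by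
  set p := (closedRange j).starProjection with hp
  have hidem : p * p = p := Submodule.isIdempotentElem_starProjection _
  have hpj (b : E) : p (j b) = j b := Submodule.starProjection_eq_self_iff.2
    ((LinearMap.range j).le_topologicalClosure (LinearMap.mem_range_self j b))
  have hle : T ≤ p := sub_nonneg.1 <| nonneg_of_forall_inner_map_nonneg (j := j)
    (by rw [← hp, mul_sub, sub_mul, hT.compress, hidem, hidem]) fun b => by
      rw [sub_apply, inner_sub_right, hpj, hT.inner_eq]
      exact sub_nonneg.2 (hj b)
  exact hle.trans isStarProjection_starProjection.le_one

theorem commute (hT : Represents j q T) {d : H →L[ℂ] H} {m m' : E → E}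
    (hm : ∀ b, d (j b) = j (m b)) (hm' : ∀ b, star d (j b) = j (m' b))
    (hqm : ∀ c b, q (m' c) b = q c (m b)) : Commute d T := by
  have hdp := commute_starProjection_closedRange (fun b => ⟨m b, (hm b).symm⟩)
    fun b => ⟨m' b, (hm' b).symm⟩
  set p := (closedRange j).starProjection
  have hcompress : p * (d * T - T * d) * p = d * T - T * d := by
    calc p * (d * T - T * d) * p = p * d * T * p - p * T * (d * p) := by noncomm_ring
      _ = d * p * T * p - p * T * (p * d) := by rw [hdp.eq]
      _ = d * (p * T * p) - p * T * p * d := by simp only [mul_assoc]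
      _ = d * T - T * d := by rw [hT.compress]
  have hinner (b : E) : ⟪j b, (d * T - T * d) (j b)⟫_ℂ = 0 := by
    rw [sub_apply, mul_apply_eq_comp, mul_apply_eq_comp, inner_sub_right,
      ← ContinuousLinearMap.adjoint_inner_left, ← ContinuousLinearMap.star_eq_adjoint, hm, hm',
      hT.inner_eq, hT.inner_eq, hqm, sub_self]
  have hge := nonneg_of_forall_inner_map_nonneg hcompress fun b => (hinner b).ge
  have hle := nonneg_of_forall_inner_map_nonneg (T := -(d * T - T * d))
    (by rw [mul_neg, neg_mul, hcompress]) fun b => by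
      rw [neg_apply, inner_neg_right, hinner, neg_zero]
  exact sub_eq_zero.1 (le_antisymm (neg_nonneg.1 hle) hge)

theorem sum_le {ι : Type*} {q : ι → E →ₗ⋆[ℂ] E →ₗ[ℂ] ℂ} {T : ι → H →L[ℂ] H}
    {q' : E →ₗ⋆[ℂ] E →ₗ[ℂ] ℂ} {T' : H →L[ℂ] H}
    (hT : ∀ i, Represents j (q i) (T i)) (hT' : Represents j q' T') (s : Finset ι)
    (h : ∀ b, ∑ i ∈ s, q i b b ≤ q' b b) :
    ∑ i ∈ s, T i ≤ T' := by
  refine sub_nonneg.1 (nonneg_of_forall_inner_map_nonneg (j := j) ?_ fun b => ?_)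
  · simp only [mul_sub, sub_mul, Finset.mul_sum, Finset.sum_mul, hT'.compress, (hT _).compress]
  · simpa [inner_sub_right, inner_sum, (hT _).inner_eq, hT'.inner_eq] using h b

theorem hasSum_inner {ι : Type*} {q : ι → E →ₗ⋆[ℂ] E →ₗ[ℂ] ℂ} {T : ι → H →L[ℂ] H}
    {q' : E →ₗ⋆[ℂ] E →ₗ[ℂ] ℂ} {T' : H →L[ℂ] H}
    (hT : ∀ i, Represents j (q i) (T i)) (hT' : Represents j q' T') (hq : ∀ i b, 0 ≤ q i b b)
    (hsum : ∀ c b, HasSum (fun i => q i c b) (q' c b)) (y z : H) :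
    HasSum (fun i => ⟪y, T i z⟫_ℂ) ⟪y, T' z⟫_ℂ := by
  have hnorm (s : Finset ι) : ‖∑ i ∈ s, T i‖ ≤ ‖T'‖ :=
    CStarAlgebra.norm_le_norm_of_nonneg_of_le
      (Finset.sum_nonneg fun i _ => (hT i).nonneg (hq i))
      (sum_le hT hT' s fun b => sum_le_hasSum s (fun i _ => hq i b) (hsum b b))
  have htendsto := tendsto_inner_of_mem_closure (l := atTop) (B := T') hnorm
    (D := LinearMap.range j) ?_ (Submodule.starProjection_apply_mem (closedRange j) y)
    (Submodule.starProjection_apply_mem (closedRange j) z)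
  · simpa [HasSum, inner_sum, inner_eq_inner_starProjection hT'.compress y z,
      inner_eq_inner_starProjection (hT _).compress y z] using htendsto
  · rintro _ ⟨c, rfl⟩ _ ⟨b, rfl⟩
    simpa [HasSum, inner_sum, (hT _).inner_eq, hT'.inner_eq] using hsum c b

end Represents

end DominatedForm

section RadonNikodym

variable {𝓑 : NonUnitalStarSubalgebra ℂ (H →L[ℂ] H)}

theorem span_range_star_mul_self {A : Type*} [NonUnitalCStarAlgebra A] :
    Submodule.span ℂ (Set.range fun a : A => star a * a) = ⊤ := by
  let _ : PartialOrder A := CStarAlgebra.spectralOrder A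
  have : StarOrderedRing A := CStarAlgebra.spectralOrderedRing A
  rw [eq_top_iff, ← CStarAlgebra.span_nonneg]
  refine Submodule.span_mono fun a ha => ?_
  obtain ⟨b, rfl⟩ := CStarAlgebra.nonneg_iff_eq_star_mul_self.1 (show 0 ≤ a from ha)
  exact ⟨b, rfl⟩

theorem dense_span_range_star_mul_self {A : Type*} [NonUnitalCStarAlgebra A]
    (𝓑 : NonUnitalStarSubalgebra ℂ A) :
    Dense (Submodule.span ℂ (Set.range fun a : 𝓑 => star a * a) : Set 𝓑) := by
  let D : Submodule ℂ A := (Submodule.span ℂ (Set.range fun a : 𝓑 => star a * a)).map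
    (NonUnitalStarSubalgebraClass.subtype 𝓑 : 𝓑 →ₗ[ℂ] A)
  have hsq : Set.MapsTo (fun a : A => star a * a) (closure 𝓑) (closure D) :=
    Set.MapsTo.closure (fun a ha => ⟨_, Submodule.subset_span ⟨⟨a, ha⟩, rfl⟩, rfl⟩) (by fun_prop)
  have : IsClosed (𝓑.topologicalClosure : Set A) := 𝓑.isClosed_topologicalClosure
  have hle : ⊤ ≤ D.topologicalClosure.comap
      (NonUnitalStarSubalgebraClass.subtype 𝓑.topologicalClosure :
        𝓑.topologicalClosure →ₗ[ℂ] A) := by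
    rw [← span_range_star_mul_self, Submodule.span_le]
    rintro _ ⟨a, rfl⟩
    exact hsq a.2
  intro b
  rw [closure_subtype]
  exact hle (Submodule.mem_top (x := ⟨b, 𝓑.le_topologicalClosure b.2⟩))

section GNSForm

variable {A : Type*} [NonUnitalRing A] [StarRing A] [Module ℂ A] [IsScalarTower ℂ A A]
  [SMulCommClass ℂ A A] [StarModule ℂ A]

/-- The sesquilinear form `(c, b) ↦ φ(c* b)` of the Gelfand-Naimark-Segal construction. -/
def gnsForm (φ : A →ₗ[ℂ] ℂ) : A →ₗ⋆[ℂ] A →ₗ[ℂ] ℂ :=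
  LinearMap.mk₂'ₛₗ (starRingEnd ℂ) (RingHom.id ℂ) (fun c b => φ (star c * b))
    (fun c c' b => by rw [star_add, add_mul, map_add])
    (fun r c b => by rw [star_smul, smul_mul_assoc, map_smul, starRingEnd_apply])
    (fun c b b' => by rw [mul_add, map_add])
    (fun r c b => by rw [mul_smul_comm, map_smul, RingHom.id_apply])

theorem gnsForm_apply (φ : A →ₗ[ℂ] ℂ) (c b : A) : gnsForm φ c b = φ (star c * b) := rfl

end GNSForm

variable (𝓑) in
/-- The map `b ↦ b x`. -/
def orbitMap (x : H) : 𝓑 →ₗ[ℂ] H where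
  toFun b := (b : H →L[ℂ] H) x
  map_add' _ _ := rfl
  map_smul' _ _ := rfl

theorem inner_orbitMap (x : H) (c b : 𝓑) :
    ⟪orbitMap 𝓑 x c, orbitMap 𝓑 x b⟫_ℂ = vectorFunctional 𝓑 x (star c * b) :=
  (ContinuousLinearMap.adjoint_inner_right (c : H →L[ℂ] H) x _).symm

theorem Represents.mem_commutant {x : H} {φ : 𝓑 →ₗ[ℂ] ℂ} {T : H →L[ℂ] H}
    (hT : Represents (orbitMap 𝓑 x) (gnsForm φ) T) : T ∈ commutant 𝓑 := by
  have hcomm (d : 𝓑) : Commute (d : H →L[ℂ] H) T :=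
    hT.commute (m := fun b => d * b) (m' := fun b => star d * b) (fun _ => rfl) (fun _ => rfl)
      fun c b => by rw [gnsForm_apply, gnsForm_apply, star_mul, star_star, mul_assoc]
  exact mem_commutant_iff.2 fun d hd => hcomm ⟨d, hd⟩

theorem Represents.inner_apply_eq {x : H} {φ : StrongDual ℂ 𝓑} {T : H →L[ℂ] H}
    (hT : Represents (orbitMap 𝓑 x) (gnsForm φ.toLinearMap) T) (b : 𝓑) :
    ⟪x, T ((b : H →L[ℂ] H) x)⟫_ℂ = φ b := by
  let ψ : StrongDual ℂ 𝓑 := innerSL ℂ x ∘L T ∘L ContinuousLinearMap.apply ℂ H x ∘L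
    𝓑.toSubmodule.subtypeL
  suffices ψ = φ from DFunLike.congr_fun this b
  refine ContinuousLinearMap.ext_on (dense_span_range_star_mul_self 𝓑) ?_
  rintro _ ⟨a, rfl⟩
  have hcomm := mem_commutant_iff.1 hT.mem_commutant _ (star a).2
  calc ⟪x, (T * (star a : 𝓑)) (orbitMap 𝓑 x a)⟫_ℂ
      = ⟪orbitMap 𝓑 x a, T (orbitMap 𝓑 x a)⟫_ℂ := by
        rw [← hcomm]
        exact ContinuousLinearMap.adjoint_inner_right (a : H →L[ℂ] H) x _
    _ = φ (star a * a) := hT.inner_eq a a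

end RadonNikodym

section OperatorMeasure

variable (H) in
/-- A positive operator valued measure on `X` with total mass at most `1`: it assigns to a
measurable set an operator between `0` and `1`, and is `σ`-additive in the weak-operator topology.
As for `CPInstrument`, the values on other sets carry no meaning. -/
structure OperatorMeasure (X : Type*) [MeasurableSpace X] where
  /-- The effect of a measurable set. -/
  effect : Set X → (H →L[ℂ] H)
  nonneg : ∀ S, 0 ≤ effect S
  le_one : ∀ S, effect S ≤ 1
  hasSum_iUnion : ∀ S : ℕ → Set X, (∀ i, MeasurableSet (S i)) →
    Pairwise (Function.onFun Disjoint S) →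
      ∀ y z : H, HasSum (fun i => ⟪y, effect (S i) z⟫_ℂ) ⟪y, effect (⋃ i, S i) z⟫_ℂ

variable {𝓑 : NonUnitalStarSubalgebra ℂ (H →L[ℂ] H)}

theorem norm_state_apply_le (ω : stateSpace 𝓑) (b : 𝓑) : ‖(ω : WeakDual ℂ 𝓑) b‖ ≤ ‖b‖ :=
  (ContinuousLinearMap.le_of_opNorm_le _ ω.2.2.le b).trans_eq (one_mul _)

variable [MeasurableSpace (stateSpace 𝓑)] [BorelSpace (stateSpace 𝓑)] (μ : Measure (stateSpace 𝓑))

section IntegralFunctional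

variable [IsFiniteMeasure μ]

theorem integrable_state_apply (b : 𝓑) :
    Integrable (fun ω : stateSpace 𝓑 => (ω : WeakDual ℂ 𝓑) b) μ :=
  .of_bound ((WeakDual.eval_continuous b).comp
    continuous_subtype_val).measurable.aestronglyMeasurable ‖b‖
    (.of_forall fun ω => norm_state_apply_le ω b)

/-- The functional `b ↦ ∫ ω(b) dμ(ω)`. -/
def integralFunctional : StrongDual ℂ 𝓑 :=
  LinearMap.mkContinuous
    { toFun := fun b => ∫ ω : stateSpace 𝓑, (ω : WeakDual ℂ 𝓑) b ∂μ
      map_add' := fun b c => by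
        simp only [map_add, integral_add (integrable_state_apply μ b) (integrable_state_apply μ c)]
      map_smul' := fun r b => by simp only [map_smul, integral_smul, RingHom.id_apply] }
    (μ.real Set.univ) fun b => (norm_integral_le_of_norm_le_const
      (.of_forall fun ω => norm_state_apply_le ω b)).trans_eq (mul_comm _ _)

theorem integralFunctional_apply (b : 𝓑) :
    integralFunctional μ b = ∫ ω : stateSpace 𝓑, (ω : WeakDual ℂ 𝓑) b ∂μ := rfl

theorem integralFunctional_star_mul_self_nonneg (b : 𝓑) :
    0 ≤ integralFunctional μ (star b * b) :=
  integral_nonneg fun ω => ω.2.1 b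

variable {μ} in
theorem integralFunctional_star_mul_self_mono {ν : Measure (stateSpace 𝓑)} [IsFiniteMeasure ν]
    (h : ν ≤ μ) (b : 𝓑) :
    integralFunctional ν (star b * b) ≤ integralFunctional μ (star b * b) :=
  integral_mono_measure h (.of_forall fun ω => ω.2.1 b) (integrable_state_apply μ _)

theorem integralFunctional_star_mul_self_le (hμ : μ.real Set.univ ≤ 1) {ρ : 𝓑 → ℂ}
    (hρ : IsBarycenter μ ρ) (b : 𝓑) : integralFunctional μ (star b * b) ≤ ρ (star b * b) := by
  have : NeZero μ := ⟨hρ.1⟩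
  rw [hρ.2, ← integralFunctional_apply]
  refine le_mul_of_one_le_left (integralFunctional_star_mul_self_nonneg μ b) ?_
  exact_mod_cast (one_le_inv₀ measureReal_univ_pos).2 hμ

end IntegralFunctional

theorem exists_operatorMeasure (hμ : μ Set.univ ≤ 1) {x : H}
    (hbar : IsBarycenter μ (vectorFunctional 𝓑 x)) :
    ∃ F : OperatorMeasure H (stateSpace 𝓑), (∀ S, F.effect S ∈ commutant 𝓑) ∧
      ∀ S, ∀ b : 𝓑, ⟪x, F.effect S ((b : H →L[ℂ] H) x)⟫_ℂ =
        ∫ ω in S, (ω : WeakDual ℂ 𝓑) b ∂μ := by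
  have : IsFiniteMeasure μ := ⟨hμ.trans_lt ENNReal.one_lt_top⟩
  have hmass : μ.real Set.univ ≤ 1 := ENNReal.toReal_le_of_le_ofReal zero_le_one (by simpa using hμ)
  let φ (S : Set (stateSpace 𝓑)) : StrongDual ℂ 𝓑 := integralFunctional (μ.restrict S)
  have hpos (S : Set (stateSpace 𝓑)) (b : 𝓑) : 0 ≤ gnsForm (φ S).toLinearMap b b :=
    integralFunctional_star_mul_self_nonneg _ b
  have hle (S : Set (stateSpace 𝓑)) (b : 𝓑) :
      gnsForm (φ S).toLinearMap b b ≤ ⟪orbitMap 𝓑 x b, orbitMap 𝓑 x b⟫_ℂ := by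
    rw [inner_orbitMap]
    exact (integralFunctional_star_mul_self_mono Measure.restrict_le_self b).trans
      (integralFunctional_star_mul_self_le μ hmass hbar b)
  choose F hF using fun S => exists_represents (hpos S) (hle S)
  exact ⟨{
      effect := F
      nonneg := fun S => (hF S).nonneg (hpos S)
      le_one := fun S => (hF S).le_one (hle S)
      hasSum_iUnion := fun S hS hdisj =>
        Represents.hasSum_inner (fun i => hF (S i)) (hF _) (fun i => hpos (S i)) fun c b =>
          hasSum_integral_iUnion hS hdisj (integrable_state_apply μ (star c * b)).integrableOn },
    fun S => (hF S).mem_commutant, fun S b => (hF S).inner_apply_eq b⟩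

end OperatorMeasure

section Instrument

variable {X : Type*} [MeasurableSpace X]

theorem compress_sqrt_apply {A : Type*} [NonUnitalCStarAlgebra A] [PartialOrder A]
    [StarOrderedRing A] {P : A →CP (H →L[ℂ] H)} {F : H →L[ℂ] H}
    (hF : 0 ≤ F) {a : A} (hcomm : Commute F (P a)) : compress P (CFC.sqrt F) a = F * P a := by
  have hsqrt : Commute (CFC.sqrt F) (P a) := hcomm.cfcₙ_nnreal _
  calc compress P (CFC.sqrt F) a
      = star (CFC.sqrt F) * (P a * CFC.sqrt F) := compress_apply P _ a
    _ = CFC.sqrt F * CFC.sqrt F * P a := by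
        rw [(CFC.sqrt_nonneg F).isSelfAdjoint.star_eq, ← hsqrt.eq, mul_assoc]
    _ = F * P a := by rw [CFC.sqrt_mul_sqrt_self F hF]

/-- The instrument `𝓔[S](T) = F(S) P(T)` given by an operator measure `F` and a unital completely
positive map `P` whose range commutes with `F`, written as `√F(S) P(T) √F(S)` so that its complete
positivity is apparent. -/
def OperatorMeasure.toCPInstrument (F : OperatorMeasure H X) (P : (H →L[ℂ] H) →CP (H →L[ℂ] H))
    (hone : P 1 = 1) (hcomm : ∀ S T, Commute (F.effect S) (P T)) : CPInstrument H X where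
  op S := compress P (CFC.sqrt (F.effect S))
  hasSum_iUnion T S hS hdisj y z := by
    simp only [compress_sqrt_apply (F.nonneg _) (hcomm _ T)]
    exact F.hasSum_iUnion S hS hdisj y (P T z)
  op_one_le S _ := by
    rw [compress_sqrt_apply (F.nonneg S) (hcomm S 1), hone, mul_one]
    exact F.le_one S

theorem OperatorMeasure.toCPInstrument_op_apply (F : OperatorMeasure H X)
    (P : (H →L[ℂ] H) →CP (H →L[ℂ] H)) (hone : P 1 = 1)
    (hcomm : ∀ S T, Commute (F.effect S) (P T)) (S : Set X) (T : H →L[ℂ] H) :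
    (F.toCPInstrument P hone hcomm).op S T = F.effect S * P T :=
  compress_sqrt_apply (F.nonneg S) (hcomm S T)

end Instrument

end HJW

end

theorem mainTheorem1_general {H : Type*} [NormedAddCommGroup H] [InnerProductSpace ℂ H]
    [CompleteSpace H] (𝓑 : NonUnitalStarSubalgebra ℂ (H →L[ℂ] H)) (x : H)
    [MeasurableSpace (HJW.stateSpace 𝓑)] [BorelSpace (HJW.stateSpace 𝓑)]
    (μ : Measure (HJW.stateSpace 𝓑)) (hμ : μ Set.univ ≤ 1)
    (hbar : HJW.IsBarycenter μ (HJW.vectorFunctional 𝓑 x))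
    (hinj : HJW.IsInjective (HJW.commutant 𝓑).commutant) :
    ∃ 𝓔 : HJW.CPInstrument H (HJW.stateSpace 𝓑),
      𝓔.IsLocalTo (HJW.commutant 𝓑) ∧
      ∀ (S : Set (HJW.stateSpace 𝓑)), MeasurableSet S → ∀ b : 𝓑,
        ⟪x, 𝓔.op S (b : H →L[ℂ] H) x⟫_ℂ = ∫ ω in S, (ω : WeakDual ℂ 𝓑) b ∂μ := by
  obtain ⟨P, hP⟩ := hinj
  obtain ⟨F, hF, hFx⟩ := HJW.exists_operatorMeasure μ hμ hbar
  have hone : P 1 = 1 := hP.apply_of_mem 1 (one_mem _)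
  have hcomm (S : Set (HJW.stateSpace 𝓑)) (T : H →L[ℂ] H) : Commute (F.effect S) (P T) :=
    VonNeumannAlgebra.mem_commutant_iff.1 (hP.apply_mem T) _ (hF S)
  refine ⟨F.toCPInstrument P hone hcomm, fun T hT S _ => ?_, fun S _ b => ?_⟩
  · rw [F.toCPInstrument_op_apply, F.toCPInstrument_op_apply, hone, mul_one, hP.apply_of_mem T hT]
  · have hb : (b : H →L[ℂ] H) ∈ (HJW.commutant 𝓑).commutant :=
      VonNeumannAlgebra.mem_commutant_iff.2 fun T hT => (HJW.mem_commutant_iff.1 hT b b.2).symm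
    rw [F.toCPInstrument_op_apply, hP.apply_of_mem _ hb]
    exact hFx S b

theorem mainTheorem1 {H : Type*} [NormedAddCommGroup H] [InnerProductSpace ℂ H] [CompleteSpace H]
    (𝓑 : NonUnitalStarSubalgebra ℂ (H →L[ℂ] H)) (h𝓑 : IsClosed (𝓑 : Set (H →L[ℂ] H)))
    (x : H) (hx : ‖x‖ = 1)
    [MeasurableSpace (HJW.stateSpace 𝓑)] [BorelSpace (HJW.stateSpace 𝓑)]
    (μ : Measure (HJW.stateSpace 𝓑)) [μ.Regular] (hμ : μ Set.univ ≤ 1)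
    (hbar : HJW.IsBarycenter μ (HJW.vectorFunctional 𝓑 x))
    (hhyp : HJW.IsHyperfinite (HJW.commutant 𝓑)) :
    ∃ 𝓔 : HJW.CPInstrument H (HJW.stateSpace 𝓑),
      𝓔.IsLocalTo (HJW.commutant 𝓑) ∧
      ∀ (S : Set (HJW.stateSpace 𝓑)), MeasurableSet S → ∀ b : 𝓑,
        ⟪x, 𝓔.op S (b : H →L[ℂ] H) x⟫_ℂ = ∫ ω in S, (ω : WeakDual ℂ 𝓑) b ∂μ :=
  mainTheorem1_general 𝓑 x μ hμ hbar hhyp.isInjective_commutant
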